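/- Let $\mathcal H$ be a nonzero complex Hilbert space and let $T$ be a bounded linear operator on $\mathcal H$ with modulus $|T|=(T^*T)^{1/2}$. Suppose that $T$ is quasinormal, that is, $T|T|=|T|T$, and pure, that is, there is no nonzero closed subspace $\mathcal M$ reducing $T$ (invariant under $T$ and $T^*$) such that $T|_{\mathcal M}$ is normal. Let $\sigma_{ext}(T)$ be the set of all $\lambda\in\mathbb C$ for which there is a nonzero bounded operator $X$ on $\mathcal H$ with $TX=\lambda XT$, let $\sigma_p(|T|)$ be the set of eigenvalues of $|T|$, and put $m_{|T|}=\inf\{\langle |T|x,x\rangle : \|x\|=1\}$. 1. If $m_{|T|}$ and $\|T\|$ both belong to $\sigma_p(|T|)$, then $\sigma_{ext}(T)=\{\lambda\in\mathbb C : |\lambda|\ge m_{|T|}/\|T\|\}$, the complement of the open disk of radius $m_{|T|}/\|T\|$ centered at $0$. 2. If $m_{|T|}$ and $\|T\|$ do not both belong to $\sigma_p(|T|)$, then $\sigma_{ext}(T)=\{\lambda\in\mathbb C : |\lambda|> m_{|T|}/\|T\|\}$, the complement of the closed disk of radius $m_{|T|}/\|T\|$ centered at $0$. -/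

import Mathlib

namespace ExtendedSpectrum

variable {H : Type*} [NormedAddCommGroup H] [InnerProductSpace ℂ H]

/-- The set of extended eigenvalues of `T`: the complex numbers `μ` for which there is a nonzero
bounded operator `X` with `T X = μ X T`. -/
def extSpectrum (T : H →L[ℂ] H) : Set ℂ :=
  {μ : ℂ | ∃ X : H →L[ℂ] H, X ≠ 0 ∧ T * X = μ • (X * T)}

/-- The point spectrum (set of eigenvalues) of `T`. -/
def pointSpectrum (T : H →L[ℂ] H) : Set ℂ :=
  {μ : ℂ | Module.End.HasEigenvalue (T : Module.End ℂ H) μ}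

/-- `m_T = inf {⟨T x, x⟩ : ‖x‖ = 1}`. For self-adjoint `T` the numbers `⟨T x, x⟩` are real;
`T.reApplyInnerSelf x` is the real part of `⟨T x, x⟩`. -/
noncomputable def lowerBd (T : H →L[ℂ] H) : ℝ :=
  sInf (T.reApplyInnerSelf '' {x : H | ‖x‖ = 1})

variable [CompleteSpace H]

/-- `T` is quasinormal: it commutes with its modulus `|T| = (T* T)^{1/2}`. -/
def IsQuasinormal (T : H →L[ℂ] H) : Prop :=
  T * CFC.abs T = CFC.abs T * T

/-- `M` reduces `T`: it is a closed subspace invariant under `T` and under its adjoint. -/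
structure Reduces (T : H →L[ℂ] H) (M : Submodule ℂ H) : Prop where
  isClosed : IsClosed (M : Set H)
  map_mem : ∀ x ∈ M, T x ∈ M
  adjoint_map_mem : ∀ x ∈ M, ContinuousLinearMap.adjoint T x ∈ M

/-- `T` is pure: there is no nonzero reducing subspace on which `T` restricts to a normal
operator. -/
def IsPure (T : H →L[ℂ] H) : Prop :=
  ∀ (M : Submodule ℂ H) (hM : Reduces T M), M ≠ ⊥ →
    haveI : CompleteSpace M := hM.isClosed.completeSpace_coe
    ¬ IsStarNormal (T.restrict (p := M) (q := M) hM.map_mem)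

end ExtendedSpectrum

namespace ExtendedSpectrum

open ContinuousLinearMap Filter Topology
open scoped InnerProductSpace

variable {H : Type*} [NormedAddCommGroup H] [InnerProductSpace ℂ H]

/-! Write `m` for the lower bound of `|T|`. Since `T* T` commutes with `T` and `T*`, its spectral
subspaces, realised as kernels of positive parts, reduce `T`; by purity each nonzero one meets `ker
T*` (`IsPure.exists_adjoint_eq_zero`).

Existence (`mem_extSpectrum_of_posPart`): take nonzero `u`, `v` in `ker T*`, with `u` where `T* T ≤
a²` and `v` where `T* T ≥ b²`. The orbit `Tⁿ u` is orthogonal with growth at most `aⁿ`, and `v`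
starts an orthogonal sequence with `T* wₙ₊₁ = wₙ` and growth at most `b⁻ⁿ`. Then `X = ∑ μ⁻ⁿ ⟪wₙ, ·⟫
Tⁿ u` is bounded if `a / b ≤ |μ|`, and it intertwines. Any `a > m` and `0 < b < ‖T‖` are available;
`a = m > 0` and `b = ‖T‖` are too when both are eigenvalues.

Necessity: `Tⁿ X = μⁿ X Tⁿ` gives `mⁿ ‖X x‖ ≤ |μ|ⁿ ‖X‖ ‖T‖ⁿ ‖x‖`, hence `|μ| ≥ m / ‖T‖`. If equality
holds and `m > 0`, the orbits of `X x` and `x` have extremal growth, which forces both eigenvalues.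
Injectivity of `T` settles `m = 0`. -/

lemma apply_of_commute {Q T : H →L[ℂ] H} (h : Commute Q T) (x : H) : Q (T x) = T (Q x) :=
  congr($(h.eq) x)

variable [CompleteSpace H]

/-! ### Quasinormal operators and their modulus -/

lemma IsQuasinormal.commute_star_mul_self {T : H →L[ℂ] H} (hq : IsQuasinormal T) :
    Commute (star T * T) T := by
  have h : Commute (CFC.abs T) T := hq.symm
  rw [← CFC.abs_mul_abs]
  exact h.mul_left h

lemma commute_star_of_isSelfAdjoint {Q T : H →L[ℂ] H} (hQ : IsSelfAdjoint Q) (h : Commute Q T) :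
    Commute Q (star T) := by
  simpa [hQ.star_eq] using h.star_star

lemma inner_star_mul_self (T : H →L[ℂ] H) (x y : H) : ⟪(star T * T) x, y⟫_ℂ = ⟪T x, T y⟫_ℂ := by
  rw [mul_apply_eq_comp, star_eq_adjoint, adjoint_inner_left]

lemma re_inner_star_mul_self (T : H →L[ℂ] H) (x : H) :
    (⟪(star T * T) x, x⟫_ℂ).re = ‖T x‖ ^ 2 := by
  rw [inner_star_mul_self, inner_self_eq_norm_sq_to_K]
  norm_cast

lemma norm_abs_apply (T : H →L[ℂ] H) (x : H) : ‖CFC.abs T x‖ = ‖T x‖ := by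
  have h : ‖CFC.abs T x‖ ^ 2 = ‖T x‖ ^ 2 := by
    rw [← re_inner_star_mul_self, ← re_inner_star_mul_self,
      (CFC.abs_nonneg T).isSelfAdjoint.star_eq, CFC.abs_mul_abs]
  exact (sq_eq_sq₀ (norm_nonneg _) (norm_nonneg _)).1 h

lemma IsQuasinormal.norm_abs_pow_apply {T : H →L[ℂ] H} (hq : IsQuasinormal T) (n : ℕ) (x : H) :
    ‖(CFC.abs T ^ n) x‖ = ‖(T ^ n) x‖ := by
  induction n generalizing x with
  | zero => simp
  | succ n ih =>
    have h : Commute (CFC.abs T) T := hq.symm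
    rw [pow_succ', mul_apply_eq_comp, norm_abs_apply, ← mul_apply_eq_comp, ← (h.pow_left n).eq, mul_apply_eq_comp, ih,
      pow_succ, mul_apply_eq_comp]

/-! ### Reducing subspaces of pure quasinormal operators -/

lemma reduces_ker {Q T : H →L[ℂ] H} (h : Commute Q T) (h' : Commute Q (star T)) :
    Reduces T (LinearMap.ker (Q : H →ₗ[ℂ] H)) where
  isClosed := Q.isClosed_ker
  map_mem x hx := by
    have hx : Q x = 0 := hx
    change Q (T x) = 0
    rw [apply_of_commute h, hx, map_zero]
  adjoint_map_mem x hx := by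
    have hx : Q x = 0 := hx
    change Q (star T x) = 0
    rw [apply_of_commute h', hx, map_zero]

lemma Reduces.isStarNormal_restrict {T : H →L[ℂ] H} {M : Submodule ℂ H} (hM : Reduces T M)
    [CompleteSpace M] (h : ∀ x ∈ M, T (adjoint T x) = adjoint T (T x)) :
    IsStarNormal (T.restrict (p := M) (q := M) hM.map_mem) := by
  have hadj : star (T.restrict (p := M) (q := M) hM.map_mem) =
      (adjoint T).restrict (p := M) (q := M) hM.adjoint_map_mem := by
    rw [star_eq_adjoint, eq_comm, eq_adjoint_iff]
    intro x y
    exact adjoint_inner_left T y x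
  refine ⟨?_⟩
  rw [hadj]
  ext x
  exact (h x x.2).symm

/-- Every nonzero reducing subspace of a pure quasinormal operator contains a nonzero vector of the
kernel of the adjoint. -/
lemma IsPure.exists_adjoint_eq_zero {T : H →L[ℂ] H} (hp : IsPure T) (hq : IsQuasinormal T)
    {M : Submodule ℂ H} (hM : Reduces T M) (hne : M ≠ ⊥) :
    ∃ u ∈ M, u ≠ 0 ∧ adjoint T u = 0 := by
  by_contra! hcon
  have : CompleteSpace M := hM.isClosed.completeSpace_coe
  refine hp M hM hne (hM.isStarNormal_restrict fun x hx => ?_)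
  rw [← sub_eq_zero]
  by_contra hz
  -- The witness is `T T* x - T* T x`: `T*` kills it because `T* T` commutes with `T*`.
  refine hcon _ (M.sub_mem (hM.map_mem _ (hM.adjoint_map_mem _ hx))
    (hM.adjoint_map_mem _ (hM.map_mem _ hx))) hz ?_
  rw [map_sub, sub_eq_zero]
  exact apply_of_commute
    (commute_star_of_isSelfAdjoint (IsSelfAdjoint.star_mul_self T) hq.commute_star_mul_self) x

/-- `ker T = ker (T* T)` reduces `T`, and `T` restricts there to zero, which is normal. -/
lemma IsPure.injective {T : H →L[ℂ] H} (hp : IsPure T) (hq : IsQuasinormal T) {x : H}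
    (hx : T x = 0) : x = 0 := by
  by_contra hx0
  have hP := hq.commute_star_mul_self
  have hM := reduces_ker hP (commute_star_of_isSelfAdjoint (IsSelfAdjoint.star_mul_self T) hP)
  have hker : ∀ y, (star T * T) y = 0 → T y = 0 := fun y hy => by
    have := re_inner_star_mul_self T y
    rw [hy, inner_zero_left] at this
    simpa using this.symm
  have : CompleteSpace (LinearMap.ker ((star T * T : H →L[ℂ] H) : H →ₗ[ℂ] H)) :=
    hM.isClosed.completeSpace_coe
  refine hp _ hM (fun h => hx0 ?_) (hM.isStarNormal_restrict fun y hy => ?_)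
  · have : x ∈ LinearMap.ker ((star T * T : H →L[ℂ] H) : H →ₗ[ℂ] H) := by
      change star T (T x) = 0
      rw [hx, map_zero]
    rw [h] at this
    simpa using this
  · rw [hker _ (hM.adjoint_map_mem y hy), hker y hy, map_zero]

/-! ### Kernels of positive parts -/

lemma commute_posPart {Q T : H →L[ℂ] H} (h : Commute Q T) : Commute Q⁺ T := by
  rw [CFC.posPart_def]
  exact h.cfcₙ_real _

/-- A self-adjoint operator is nonpositive on the kernel of its positive part. -/
lemma re_inner_nonpos_of_posPart_apply_eq_zero {Q : H →L[ℂ] H} (hQ : IsSelfAdjoint Q) {x : H}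
    (hx : Q⁺ x = 0) : (⟪Q x, x⟫_ℂ).re ≤ 0 := by
  have h := congr($(CFC.posPart_sub_negPart Q hQ) x)
  have hpos := ((nonneg_iff_isPositive _).1 (CFC.negPart_nonneg Q)).re_inner_nonneg_left x
  rw [sub_apply, hx, zero_sub] at h
  rw [← h, inner_neg_left]
  simpa using hpos

lemma posPart_apply_eq_zero {Q : H →L[ℂ] H} (hQ : IsSelfAdjoint Q) {x : H} (hx : Q x = 0) :
    Q⁺ x = 0 := by
  have hsa : IsSelfAdjoint Q⁺ := (CFC.posPart_nonneg Q).isSelfAdjoint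
  have hmul : Q⁺ * Q⁺ = Q⁺ * Q := by
    have h := congr(Q⁺ * $(CFC.posPart_sub_negPart Q hQ))
    rwa [mul_sub, CFC.posPart_mul_negPart, sub_zero] at h
  have h := re_inner_star_mul_self Q⁺ x
  rw [hsa.star_eq, hmul, mul_apply_eq_comp, hx, map_zero, inner_zero_left] at h
  simpa using h.symm

/-- The range of `Q⁻` lies in `ker Q⁺`, because `Q⁺ Q⁻ = 0`. -/
lemma exists_posPart_apply_eq_zero {Q : H →L[ℂ] H} (hQ : IsSelfAdjoint Q) (hneg : ¬ 0 ≤ Q) :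
    ∃ x ≠ 0, Q⁺ x = 0 := by
  have hne : Q⁻ ≠ 0 := fun h => hneg ((CFC.negPart_eq_zero_iff Q hQ).1 h)
  obtain ⟨y, hy⟩ : ∃ y, Q⁻ y ≠ 0 := by
    by_contra! h
    exact hne (ext h)
  refine ⟨_, hy, ?_⟩
  rw [← mul_apply_eq_comp, CFC.posPart_mul_negPart, zero_apply]

lemma IsPure.exists_adjoint_eq_zero_of_posPart {T Q : H →L[ℂ] H} (hp : IsPure T)
    (hq : IsQuasinormal T) (hQ : IsSelfAdjoint Q) (hcomm : Commute Q T)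
    (h : ∃ x ≠ 0, Q⁺ x = 0) : ∃ u ≠ 0, adjoint T u = 0 ∧ Q⁺ u = 0 := by
  obtain ⟨x, hx0, hx⟩ := h
  have hM := reduces_ker (commute_posPart hcomm)
    (commute_posPart (commute_star_of_isSelfAdjoint hQ hcomm))
  obtain ⟨u, hu, hu0, hTu⟩ := hp.exists_adjoint_eq_zero hq hM fun hbot => by
    have : x ∈ LinearMap.ker ((Q⁺ : H →L[ℂ] H) : H →ₗ[ℂ] H) := hx
    rw [hbot] at this
    exact hx0 (by simpa using this)
  exact ⟨u, hu0, hTu, hu⟩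

end ExtendedSpectrum

namespace ExtendedSpectrum

open ContinuousLinearMap Filter Topology
open scoped InnerProductSpace

variable {H : Type*} [NormedAddCommGroup H] [InnerProductSpace ℂ H]

/-! ### Construction of intertwining operators -/

lemma orthonormal_normalize {w : ℕ → H} (h0 : ∀ n, w n ≠ 0)
    (h : Pairwise fun i j => ⟪w i, w j⟫_ℂ = 0) :
    Orthonormal ℂ fun n => ((‖w n‖⁻¹ : ℝ) : ℂ) • w n := by
  refine ⟨fun n => ?_, fun i j hij => ?_⟩
  · rw [norm_smul, Complex.norm_real, norm_inv, norm_norm,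
      inv_mul_cancel₀ (norm_ne_zero_iff.2 (h0 n))]
  · simp only [inner_smul_left, inner_smul_right, h hij, mul_zero]

variable [CompleteSpace H]

/-- If `f` and `w` are orthogonal sequences and `‖c n‖ * ‖w n‖ * ‖f n‖` is bounded, then
`x ↦ ∑ n, c n * ⟪w n, x⟫ • f n` is a bounded operator. -/
lemma exists_hasSum_inner_smul {f w : ℕ → H} {c : ℕ → ℂ} {C : ℝ} (hf0 : ∀ n, f n ≠ 0)
    (hw0 : ∀ n, w n ≠ 0) (hf : Pairwise fun i j => ⟪f i, f j⟫_ℂ = 0)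
    (hw : Pairwise fun i j => ⟪w i, w j⟫_ℂ = 0) (hC : ∀ n, ‖c n‖ * ‖w n‖ * ‖f n‖ ≤ C) :
    ∃ X : H →L[ℂ] H, ∀ x, HasSum (fun n => (c n * ⟪w n, x⟫_ℂ) • f n) (X x) := by
  have hfo := orthonormal_normalize hf0 hf
  have hwo := orthonormal_normalize hw0 hw
  have hsum : ∀ x, Summable fun n => (c n * ⟪w n, x⟫_ℂ) • f n := fun x => by
    -- Bessel's inequality for the normalized `w n`, weighted by the uniform bound `C`.
    have h1 : Summable fun n => ‖(c n * ⟪w n, x⟫_ℂ) * (‖f n‖ : ℂ)‖ ^ 2 := by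
      refine Summable.of_nonneg_of_le (fun n => by positivity) (fun n => ?_)
        ((hwo.inner_products_summable (x := x)).mul_left (C ^ 2))
      rw [← mul_pow]
      refine pow_le_pow_left₀ (norm_nonneg _) ?_ 2
      have hwn : (0 : ℝ) < ‖w n‖ := norm_pos_iff.2 (hw0 n)
      have h2 : ‖⟪((‖w n‖⁻¹ : ℝ) : ℂ) • w n, x⟫_ℂ‖ = ‖w n‖⁻¹ * ‖⟪w n, x⟫_ℂ‖ := by
        rw [inner_smul_left, norm_mul, RCLike.norm_conj, Complex.norm_real, norm_inv, norm_norm]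
      rw [h2, norm_mul, norm_mul, Complex.norm_real, norm_norm]
      calc ‖c n‖ * ‖⟪w n, x⟫_ℂ‖ * ‖f n‖
          = ‖c n‖ * ‖w n‖ * ‖f n‖ * (‖w n‖⁻¹ * ‖⟪w n, x⟫_ℂ‖) := by field_simp
        _ ≤ C * (‖w n‖⁻¹ * ‖⟪w n, x⟫_ℂ‖) := by gcongr; exact hC n
    have h3 := (hfo.orthogonalFamily.summable_iff_norm_sq_summable
      fun n => (c n * ⟪w n, x⟫_ℂ) * (‖f n‖ : ℂ)).2 h1
    refine h3.congr fun n => ?_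
    have hfn : (‖f n‖ : ℂ) ≠ 0 := by exact_mod_cast norm_ne_zero_iff.2 (hf0 n)
    rw [LinearIsometry.toSpanSingleton_apply, smul_smul, Complex.ofReal_inv,
      mul_inv_cancel_right₀ hfn]
  let g : ℕ → H →L[ℂ] H := fun N =>
    ∑ n ∈ Finset.range N, (innerSL ℂ (w n)).smulRight (c n • f n)
  have hg : ∀ N x, g N x = ∑ n ∈ Finset.range N, (c n * ⟪w n, x⟫_ℂ) • f n := fun N x => by
    simp only [g, sum_apply, smulRight_apply, innerSL_apply_apply, smul_smul, mul_comm]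
  have hlim : Tendsto (fun N x => g N x) atTop (𝓝 fun x => ∑' n, (c n * ⟪w n, x⟫_ℂ) • f n) := by
    rw [tendsto_pi_nhds]
    intro x
    simp only [hg]
    exact (hsum x).hasSum.tendsto_sum_nat
  -- Boundedness of the pointwise limit comes from Banach–Steinhaus.
  exact ⟨continuousLinearMapOfTendsto g hlim, fun x => (hsum x).hasSum⟩

/-- `T` shifts `f` forward and `T*` shifts `w` backward, so `∑ μ⁻ⁿ ⟪wₙ, ·⟫ fₙ` intertwines after
reindexing; the zeroth term of `X T` drops out as `T* w₀ = 0`. -/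
lemma mem_extSpectrum_of_orthogonal {T : H →L[ℂ] H} {f w : ℕ → H} {μ : ℂ} {C : ℝ} (hμ : μ ≠ 0)
    (hf0 : ∀ n, f n ≠ 0) (hw0 : ∀ n, w n ≠ 0) (hf : Pairwise fun i j => ⟪f i, f j⟫_ℂ = 0)
    (hw : Pairwise fun i j => ⟪w i, w j⟫_ℂ = 0) (hTf : ∀ n, T (f n) = f (n + 1))
    (hTw0 : adjoint T (w 0) = 0) (hTw : ∀ n, adjoint T (w (n + 1)) = w n)
    (hC : ∀ n, ‖w n‖ * ‖f n‖ ≤ C * ‖μ‖ ^ n) : μ ∈ extSpectrum T := by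
  obtain ⟨X, hX⟩ := exists_hasSum_inner_smul (c := fun n => (μ ^ n)⁻¹) (C := C) hf0 hw0 hf hw
    fun n => by
      have : 0 < ‖μ‖ ^ n := pow_pos (norm_pos_iff.2 hμ) n
      rw [mul_assoc, norm_inv, norm_pow, inv_mul_le_iff₀ this, mul_comm (‖μ‖ ^ n)]
      exact hC n
  refine ⟨X, fun h => ?_, ?_⟩
  · have h1 : HasSum (fun n => ((μ ^ n)⁻¹ * ⟪w n, w 0⟫_ℂ) • f n)
        (((μ ^ 0)⁻¹ * ⟪w 0, w 0⟫_ℂ) • f 0) :=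
      hasSum_single 0 fun n hn => by rw [hw hn, mul_zero, zero_smul]
    have h2 := h1.unique (hX (w 0))
    rw [h, zero_apply] at h2
    simp [hf0 0, hw0 0] at h2
  · ext x
    have h1 := (hX x).mapL T
    have h2 := (hX (T x)).const_smul μ
    rw [← hasSum_nat_add_iff' 1] at h2
    refine h1.unique ?_
    convert h2 using 1
    · ext n
      rw [map_smul, hTf, smul_smul, ← adjoint_inner_left, hTw, pow_succ]
      congr 1
      field_simp
    · simp [← adjoint_inner_left, hTw0]

end ExtendedSpectrum

namespace ExtendedSpectrum

open ContinuousLinearMap Filter Topology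
open scoped InnerProductSpace

variable {H : Type*} [NormedAddCommGroup H] [InnerProductSpace ℂ H]

lemma re_inner_smul_one (r : ℝ) (x : H) :
    (⟪(r • (1 : H →L[ℂ] H)) x, x⟫_ℂ).re = r * ‖x‖ ^ 2 := by
  rw [smul_apply, one_apply_eq_self, ← Complex.coe_smul, inner_smul_left, Complex.conj_ofReal,
    Complex.re_ofReal_mul, inner_self_eq_norm_sq_to_K]
  norm_cast

variable [CompleteSpace H]

/-! ### Orthogonal orbits -/

/-- One `T` is stripped from each side at the cost of replacing `x` by `T* T x`, which stays in `ker
T*`. -/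
lemma inner_pow_apply_pow_add_eq_zero {T : H →L[ℂ] H} (hP : Commute (star T * T) T) (i k : ℕ)
    {x : H} (hx : adjoint T x = 0) (y : H) : ⟪(T ^ i) x, (T ^ (i + (k + 1))) y⟫_ℂ = 0 := by
  induction i generalizing x with
  | zero =>
    rw [zero_add, pow_succ', mul_apply_eq_comp, ← adjoint_inner_left, pow_zero, one_apply_eq_self,
      hx, inner_zero_left]
  | succ i ih =>
    have hPx : adjoint T ((star T * T) x) = 0 := by
      have h := apply_of_commute
        (commute_star_of_isSelfAdjoint (IsSelfAdjoint.star_mul_self T) hP) x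
      rw [star_eq_adjoint, hx, map_zero] at h
      exact h.symm
    rw [add_right_comm, pow_succ', pow_succ', mul_apply_eq_comp, mul_apply_eq_comp,
      ← inner_star_mul_self, apply_of_commute (hP.pow_right i)]
    exact ih hPx

lemma inner_pow_apply_pow_apply_eq_zero {T : H →L[ℂ] H} (hP : Commute (star T * T) T) {i j : ℕ}
    (hij : i ≠ j) {x y : H} (hx : adjoint T x = 0) (hy : adjoint T y = 0) :
    ⟪(T ^ i) x, (T ^ j) y⟫_ℂ = 0 := by
  rcases lt_or_gt_of_ne hij with h | h
  · obtain ⟨k, rfl⟩ := Nat.exists_eq_add_of_lt h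
    exact inner_pow_apply_pow_add_eq_zero hP i k hx y
  · obtain ⟨k, rfl⟩ := Nat.exists_eq_add_of_lt h
    rw [inner_eq_zero_symm]
    exact inner_pow_apply_pow_add_eq_zero hP j k hy x

lemma isSelfAdjoint_smul_one (r : ℝ) : IsSelfAdjoint (r • (1 : H →L[ℂ] H)) :=
  (IsSelfAdjoint.all r).smul (IsSelfAdjoint.one _)

lemma norm_pow_apply_le {T : H →L[ℂ] H} (hP : Commute (star T * T) T) {a : ℝ} (ha : 0 ≤ a) {u : H}
    (hu : (star T * T - a ^ 2 • 1)⁺ u = 0) (n : ℕ) : ‖(T ^ n) u‖ ≤ a ^ n * ‖u‖ := by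
  have hsa : IsSelfAdjoint (star T * T - a ^ 2 • (1 : H →L[ℂ] H)) :=
    (IsSelfAdjoint.star_mul_self T).sub (isSelfAdjoint_smul_one _)
  have hcomm : Commute (star T * T - a ^ 2 • (1 : H →L[ℂ] H)) T :=
    hP.sub_left ((Commute.one_left T).smul_left _)
  induction n generalizing u with
  | zero => simp
  | succ n ih =>
    have h1 : ‖T u‖ ≤ a * ‖u‖ := by
      have h := re_inner_nonpos_of_posPart_apply_eq_zero hsa hu
      rw [sub_apply, inner_sub_left, Complex.sub_re, re_inner_star_mul_self,
        re_inner_smul_one] at h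
      refine (sq_le_sq₀ (norm_nonneg _) (by positivity)).1 ?_
      rw [mul_pow]
      linarith
    have h2 : (star T * T - a ^ 2 • (1 : H →L[ℂ] H))⁺ (T u) = 0 := by
      rw [apply_of_commute (commute_posPart hcomm), hu, map_zero]
    calc ‖(T ^ (n + 1)) u‖ = ‖(T ^ n) (T u)‖ := by rw [pow_succ, mul_apply_eq_comp]
      _ ≤ a ^ n * ‖T u‖ := ih h2
      _ ≤ a ^ n * (a * ‖u‖) := by gcongr
      _ = a ^ (n + 1) * ‖u‖ := by ring

/-- The operator `max (T* T) (b ^ 2)` is invertible. -/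
lemma isUnit_star_mul_self_add_posPart (T : H →L[ℂ] H) {b : ℝ} (hb : 0 < b) :
    IsUnit (star T * T + (b ^ 2 • 1 - star T * T)⁺) := by
  have hsa : IsSelfAdjoint (b ^ 2 • (1 : H →L[ℂ] H) - star T * T) :=
    (isSelfAdjoint_smul_one _).sub (IsSelfAdjoint.star_mul_self T)
  have hle : b ^ 2 • (1 : H →L[ℂ] H) ≤ star T * T + (b ^ 2 • 1 - star T * T)⁺ := by
    have := CFC.le_posPart hsa
    rw [sub_le_iff_le_add] at this
    rwa [add_comm]
  refine isUnit_of_forall_le_norm_inner_map _ (c := ⟨b ^ 2, by positivity⟩)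
    (NNReal.coe_pos.1 (pow_pos hb 2)) fun x => ?_
  have hpos := ((le_def _ _).1 hle).re_inner_nonneg_left x
  rw [sub_apply, inner_sub_left] at hpos
  have h := re_inner_smul_one (b ^ 2) x
  refine le_trans ?_ (Complex.re_le_norm _)
  simp only [map_sub, RCLike.re_to_complex] at hpos
  rw [h] at hpos
  rw [mul_comm]
  exact sub_nonneg.1 hpos

/-- On the spectral subspace where `T* T ≥ b ^ 2`, a vector of the kernel of `T*` starts an
orthogonal backward orbit of `T*` with geometric growth of rate at most `b⁻¹`. -/
lemma exists_backward_orbit {T : H →L[ℂ] H} (hP : Commute (star T * T) T) {b : ℝ} (hb : 0 < b)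
    {v : H} (hTv : adjoint T v = 0) (hv : (b ^ 2 • 1 - star T * T)⁺ v = 0) :
    ∃ w : ℕ → H, w 0 = v ∧ (∀ n, adjoint T (w (n + 1)) = w n) ∧
      (∀ n, b ^ n * ‖w n‖ ≤ ‖v‖) ∧ Pairwise fun i j => ⟪w i, w j⟫_ℂ = 0 := by
  set Q := (b ^ 2 • (1 : H →L[ℂ] H) - star T * T)
  have hsa : IsSelfAdjoint Q :=
    (isSelfAdjoint_smul_one _).sub (IsSelfAdjoint.star_mul_self T)
  have hcomm : Commute Q T := ((Commute.one_left T).smul_left _).sub_left hP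
  have hcomm' := commute_star_of_isSelfAdjoint hsa hcomm
  have hP' := commute_star_of_isSelfAdjoint (IsSelfAdjoint.star_mul_self T) hP
  obtain ⟨U, hU⟩ := isUnit_star_mul_self_add_posPart T hb
  have hUT : Commute ((U⁻¹ : (H →L[ℂ] H)ˣ) : H →L[ℂ] H) T := by
    refine Commute.units_inv_left ?_
    rw [hU]
    exact hP.add_left (commute_posPart hcomm)
  have hUT' : Commute ((U⁻¹ : (H →L[ℂ] H)ˣ) : H →L[ℂ] H) (star T) := by
    refine Commute.units_inv_left ?_
    rw [hU]
    exact hP'.add_left (commute_posPart hcomm')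
  have hUQ : Commute ((U⁻¹ : (H →L[ℂ] H)ˣ) : H →L[ℂ] H) Q⁺ := by
    refine Commute.units_inv_left ?_
    rw [hU]
    refine Commute.add_left ?_ (Commute.refl _)
    exact (commute_posPart (hcomm'.mul_right hcomm)).symm
  -- `G` inverts `max (T* T) (b²)`, hence inverts `T* T` on `ker Q⁺`. There `T* (T G) = 1`, so the
  -- orbit is `wₙ = (T G)ⁿ v`.
  set G : H →L[ℂ] H := ((U⁻¹ : (H →L[ℂ] H)ˣ) : H →L[ℂ] H)
  have hGker : ∀ y, Q⁺ y = 0 → Q⁺ (G y) = 0 := fun y hy => by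
    rw [← apply_of_commute hUQ, hy, map_zero]
  have hPG : ∀ y, Q⁺ y = 0 → (star T * T) (G y) = y := fun y hy => by
    have h : ((U : H →L[ℂ] H) * G) y = y := by simp [G]
    rwa [hU, mul_apply_eq_comp, add_apply, hGker y hy, add_zero] at h
  have hTGker : ∀ y, Q⁺ y = 0 → Q⁺ ((T * G) y) = 0 := fun y hy => by
    rw [mul_apply_eq_comp, apply_of_commute (commute_posPart hcomm), hGker y hy, map_zero]
  have hker : ∀ n, Q⁺ (((T * G) ^ n) v) = 0 := fun n => by
    induction n with
    | zero => simpa using hv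
    | succ n ih =>
      rw [pow_succ', mul_apply_eq_comp]
      exact hTGker _ ih
  have hnorm : ∀ y, Q⁺ y = 0 → b * ‖(T * G) y‖ ≤ ‖y‖ := fun y hy => by
    have h1 : b * ‖G y‖ ≤ ‖T (G y)‖ := by
      have h := re_inner_nonpos_of_posPart_apply_eq_zero hsa (hGker y hy)
      rw [sub_apply, inner_sub_left, Complex.sub_re, re_inner_star_mul_self,
        re_inner_smul_one] at h
      refine (sq_le_sq₀ (by positivity) (norm_nonneg _)).1 ?_
      rw [mul_pow]
      linarith
    have h2 : ‖T (G y)‖ ^ 2 ≤ ‖y‖ * ‖G y‖ := by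
      rw [← re_inner_star_mul_self, hPG y hy]
      exact (Complex.re_le_norm _).trans (norm_inner_le_norm _ _)
    rw [mul_apply_eq_comp]
    rcases (norm_nonneg (T (G y))).eq_or_lt with h0 | h0
    · rw [← h0, mul_zero]
      exact norm_nonneg _
    · refine le_of_mul_le_mul_right ?_ h0
      nlinarith [norm_nonneg y]
  refine ⟨fun n => ((T * G) ^ n) v, by simp, fun n => ?_, fun n => ?_, fun i j hij => ?_⟩
  · change star T (((T * G) ^ (n + 1)) v) = _
    rw [pow_succ', mul_apply_eq_comp, mul_apply_eq_comp, ← mul_apply_eq_comp]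
    exact hPG _ (hker n)
  · induction n with
    | zero => simp
    | succ n ih =>
      refine le_trans ?_ ih
      have h := mul_le_mul_of_nonneg_left (hnorm _ (hker n)) (pow_nonneg hb.le n)
      rw [← mul_apply_eq_comp, ← pow_succ', ← mul_assoc, ← pow_succ] at h
      exact h
  -- As `T` and `G` commute, `wₙ = Tⁿ Gⁿ v` with `Gⁿ v` in `ker T*`, so forward orthogonality
  -- applies.
  · have hG : ∀ n, adjoint T ((G ^ n) v) = 0 := fun n => by
      have h := apply_of_commute (hUT'.pow_left n) v
      rw [star_eq_adjoint, hTv, map_zero] at h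
      exact h.symm
    simp only [hUT.symm.mul_pow, mul_apply_eq_comp]
    exact inner_pow_apply_pow_apply_eq_zero hP hij (hG i) (hG j)

/-- A sufficient condition for being an extended eigenvalue, in terms of the spectral subspaces of
`T* T`. -/
lemma mem_extSpectrum_of_posPart {T : H →L[ℂ] H} (hp : IsPure T) (hq : IsQuasinormal T) {a b : ℝ}
    (ha : 0 ≤ a) (hb : 0 < b) (hu : ∃ x ≠ 0, (star T * T - a ^ 2 • (1 : H →L[ℂ] H))⁺ x = 0)
    (hv : ∃ x ≠ 0, (b ^ 2 • (1 : H →L[ℂ] H) - star T * T)⁺ x = 0) {μ : ℂ} (hμ0 : μ ≠ 0)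
    (hμ : a / b ≤ ‖μ‖) : μ ∈ extSpectrum T := by
  have hP := hq.commute_star_mul_self
  obtain ⟨u, hu0, hTu, hu⟩ := hp.exists_adjoint_eq_zero_of_posPart hq
    ((IsSelfAdjoint.star_mul_self T).sub (isSelfAdjoint_smul_one _))
    (hP.sub_left ((Commute.one_left T).smul_left _)) hu
  obtain ⟨v, hv0, hTv, hv⟩ := hp.exists_adjoint_eq_zero_of_posPart hq
    ((isSelfAdjoint_smul_one _).sub (IsSelfAdjoint.star_mul_self T))
    (((Commute.one_left T).smul_left _).sub_left hP) hv
  obtain ⟨w, hw, hTw, hwn, hwo⟩ := exists_backward_orbit hP hb hTv hv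
  refine mem_extSpectrum_of_orthogonal (f := fun n => (T ^ n) u) (w := w) (C := ‖v‖ * ‖u‖) hμ0
    (fun n => ?_) (fun n => ?_) (fun i j hij => inner_pow_apply_pow_apply_eq_zero hP hij hTu hTu)
    hwo (fun n => ?_) (by rw [hw, hTv]) hTw fun n => ?_
  · induction n with
    | zero => simpa using hu0
    | succ n ih =>
      intro h
      rw [pow_succ', mul_apply_eq_comp] at h
      exact ih (hp.injective hq h)
  · induction n with
    | zero => rwa [hw]
    | succ n ih =>
      intro h
      have := hTw n
      rw [h, map_zero] at this
      exact ih this.symm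
  · rw [pow_succ', mul_apply_eq_comp]
  · have h1 := norm_pow_apply_le hP ha hu n
    have h2 : a ^ n ≤ b ^ n * ‖μ‖ ^ n := by
      rw [← mul_pow]
      refine pow_le_pow_left₀ ha ?_ n
      rw [div_le_iff₀ hb] at hμ
      linarith
    calc ‖w n‖ * ‖(T ^ n) u‖ ≤ ‖w n‖ * (b ^ n * ‖μ‖ ^ n * ‖u‖) := by
          gcongr
          exact h1.trans (by gcongr)
      _ = (b ^ n * ‖w n‖) * ‖u‖ * ‖μ‖ ^ n := by ring
      _ ≤ ‖v‖ * ‖u‖ * ‖μ‖ ^ n := by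
          gcongr
          exact hwn n

end ExtendedSpectrum

namespace ExtendedSpectrum

open ContinuousLinearMap Filter Topology
open scoped InnerProductSpace

variable {H : Type*} [NormedAddCommGroup H] [InnerProductSpace ℂ H]

/-! ### Eigenvectors and orbit norms under an intertwining relation. -/

lemma mem_pointSpectrum_iff {T : H →L[ℂ] H} {μ : ℂ} :
    μ ∈ pointSpectrum T ↔ ∃ x ≠ 0, T x = μ • x := by
  constructor
  · intro h
    obtain ⟨x, hx⟩ := Module.End.HasEigenvalue.exists_hasEigenvector h
    exact ⟨x, hx.2, hx.apply_eq_smul⟩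
  · rintro ⟨x, hx0, hx⟩
    exact Module.End.hasEigenvalue_of_hasEigenvector
      ⟨Module.End.mem_eigenspace_iff.2 hx, hx0⟩

lemma norm_pow_apply_of_mul_eq {T X : H →L[ℂ] H} {μ : ℂ} (h : T * X = μ • (X * T)) (n : ℕ) (x : H) :
    ‖(T ^ n) (X x)‖ = ‖μ‖ ^ n * ‖X ((T ^ n) x)‖ := by
  induction n generalizing x with
  | zero => simp
  | succ n ih =>
    have h1 : T (X x) = μ • X (T x) := congr($h x)
    rw [pow_succ, mul_apply_eq_comp, mul_apply_eq_comp, h1, map_smul, norm_smul, ih, pow_succ']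
    ring

lemma norm_pow_apply_le_of_mul_eq {T X : H →L[ℂ] H} {μ : ℂ} (h : T * X = μ • (X * T)) (n : ℕ)
    (x : H) : ‖(T ^ n) (X x)‖ ≤ ‖μ‖ ^ n * (‖X‖ * ‖(T ^ n) x‖) := by
  rw [norm_pow_apply_of_mul_eq h]
  gcongr
  exact X.le_opNorm _

lemma norm_pow_apply_le_opNorm_pow (T : H →L[ℂ] H) (n : ℕ) (x : H) :
    ‖(T ^ n) x‖ ≤ ‖T‖ ^ n * ‖x‖ := by
  induction n with
  | zero => simp
  | succ n ih =>
    rw [pow_succ', mul_apply_eq_comp, pow_succ', mul_assoc]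
    exact T.le_opNorm_of_le ih

variable [CompleteSpace H]

/-! ### The lower bound of the modulus -/

lemma re_inner_abs_nonneg (T : H →L[ℂ] H) (x : H) : 0 ≤ (⟪CFC.abs T x, x⟫_ℂ).re :=
  ((nonneg_iff_isPositive _).1 (CFC.abs_nonneg T)).re_inner_nonneg_left x

lemma lowerBd_abs_nonneg (T : H →L[ℂ] H) : 0 ≤ lowerBd (CFC.abs T) := by
  refine Real.sInf_nonneg ?_
  rintro _ ⟨x, -, rfl⟩
  exact re_inner_abs_nonneg T x

lemma lowerBd_abs_mul_le (T : H →L[ℂ] H) (x : H) :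
    lowerBd (CFC.abs T) * ‖x‖ ^ 2 ≤ (⟪CFC.abs T x, x⟫_ℂ).re := by
  rcases eq_or_ne x 0 with rfl | hx
  · simp
  have hx' : 0 < ‖x‖ := norm_pos_iff.2 hx
  have h : lowerBd (CFC.abs T) ≤
      (⟪CFC.abs T (((‖x‖⁻¹ : ℝ) : ℂ) • x), ((‖x‖⁻¹ : ℝ) : ℂ) • x⟫_ℂ).re := by
    refine csInf_le ⟨0, ?_⟩ ⟨((‖x‖⁻¹ : ℝ) : ℂ) • x, ?_, rfl⟩
    · rintro _ ⟨y, -, rfl⟩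
      exact re_inner_abs_nonneg T y
    · rw [Set.mem_ofPred_eq, norm_smul, Complex.norm_real, norm_inv, norm_norm,
        inv_mul_cancel₀ hx'.ne']
  rw [map_smul, inner_smul_left, inner_smul_right, Complex.conj_ofReal, Complex.re_ofReal_mul,
    Complex.re_ofReal_mul, ← mul_assoc, ← mul_inv, ← sq, ← div_eq_inv_mul,
    le_div_iff₀ (by positivity)] at h
  exact h

lemma lowerBd_abs_mul_norm_le (T : H →L[ℂ] H) (x : H) :
    lowerBd (CFC.abs T) * ‖x‖ ≤ ‖T x‖ := by
  rcases eq_or_ne x 0 with rfl | hx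
  · simp
  have h : (⟪CFC.abs T x, x⟫_ℂ).re ≤ ‖T x‖ * ‖x‖ := by
    rw [← norm_abs_apply]
    exact (Complex.re_le_norm _).trans (norm_inner_le_norm _ _)
  refine le_of_mul_le_mul_right ?_ (norm_pos_iff.2 hx)
  rw [mul_assoc, ← sq]
  exact (lowerBd_abs_mul_le T x).trans h

lemma lowerBd_abs_pow_mul_norm_le (T : H →L[ℂ] H) (n : ℕ) (x : H) :
    lowerBd (CFC.abs T) ^ n * ‖x‖ ≤ ‖(T ^ n) x‖ := by
  induction n with
  | zero => simp
  | succ n ih =>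
    rw [pow_succ', mul_assoc, pow_succ', mul_apply_eq_comp]
    exact (mul_le_mul_of_nonneg_left ih (lowerBd_abs_nonneg T)).trans
      (lowerBd_abs_mul_norm_le T _)

/-- Otherwise `T* T ≥ a²`, and operator monotonicity of the square root gives `|T| ≥ a`. -/
lemma exists_posPart_of_lowerBd_lt [Nontrivial H] {T : H →L[ℂ] H} {a : ℝ}
    (ha : lowerBd (CFC.abs T) < a) :
    ∃ x ≠ 0, (star T * T - a ^ 2 • (1 : H →L[ℂ] H))⁺ x = 0 := by
  refine exists_posPart_apply_eq_zero
    ((IsSelfAdjoint.star_mul_self T).sub (isSelfAdjoint_smul_one _)) fun h => ha.not_ge ?_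
  have ha0 : 0 ≤ a := (lowerBd_abs_nonneg T).trans ha.le
  have h1 : a • (1 : H →L[ℂ] H) ≤ CFC.abs T := by
    have hsq : (a • (1 : H →L[ℂ] H)) * (a • (1 : H →L[ℂ] H)) = a ^ 2 • 1 := by
      rw [smul_mul_smul_comm, one_mul, sq]
    have := CFC.sqrt_le_sqrt _ _ (sub_nonneg.1 h)
    rwa [← hsq, CFC.sqrt_mul_self _ (smul_nonneg ha0 zero_le_one)] at this
  obtain ⟨x, hx⟩ := exists_norm_eq H zero_le_one
  refine le_csInf ⟨_, x, hx, rfl⟩ ?_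
  rintro _ ⟨y, hy, rfl⟩
  have hy : ‖y‖ = 1 := hy
  have hpos := ((le_def _ _).1 h1).re_inner_nonneg_left y
  rw [sub_apply, inner_sub_left] at hpos
  simp only [map_sub, RCLike.re_to_complex, re_inner_smul_one, hy] at hpos
  rw [one_pow, mul_one] at hpos
  exact sub_nonneg.1 hpos

lemma exists_posPart_of_lt_norm {T : H →L[ℂ] H} {b : ℝ} (hb0 : 0 ≤ b) (hb : b < ‖T‖) :
    ∃ x ≠ 0, (b ^ 2 • (1 : H →L[ℂ] H) - star T * T)⁺ x = 0 := by
  refine exists_posPart_apply_eq_zero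
    ((isSelfAdjoint_smul_one _).sub (IsSelfAdjoint.star_mul_self T)) fun h => hb.not_ge ?_
  refine T.opNorm_le_bound hb0 fun x => ?_
  have hpos := ((nonneg_iff_isPositive _).1 h).re_inner_nonneg_left x
  rw [sub_apply, inner_sub_left] at hpos
  simp only [map_sub, RCLike.re_to_complex, re_inner_smul_one, re_inner_star_mul_self] at hpos
  refine (sq_le_sq₀ (norm_nonneg _) (by positivity)).1 ?_
  rw [mul_pow]
  exact sub_nonneg.1 hpos

lemma exists_star_mul_self_apply_eq {T : H →L[ℂ] H} {t : ℝ}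
    (ht : (t : ℂ) ∈ pointSpectrum (CFC.abs T)) :
    ∃ x ≠ 0, (star T * T) x = (t ^ 2 • (1 : H →L[ℂ] H)) x := by
  obtain ⟨x, hx0, hx⟩ := mem_pointSpectrum_iff.1 ht
  refine ⟨x, hx0, ?_⟩
  rw [← CFC.abs_mul_abs, mul_apply_eq_comp, hx, map_smul, hx, smul_smul, smul_apply,
    one_apply_eq_self, ← Complex.coe_smul, Complex.ofReal_pow, sq]

/-- The vector `z = (|T| - t) x` satisfies `|T| z = -t z`, so positivity of `|T|` forces `z = 0`. -/
lemma mem_pointSpectrum_abs {T : H →L[ℂ] H} {t : ℝ} (ht : 0 < t) {x : H} (hx0 : x ≠ 0)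
    (hx : (star T * T) x = (t ^ 2 : ℝ) • x) : (t : ℂ) ∈ pointSpectrum (CFC.abs T) := by
  refine mem_pointSpectrum_iff.2 ⟨x, hx0, sub_eq_zero.1 ?_⟩
  set z := CFC.abs T x - (t : ℂ) • x with hz
  have h1 : CFC.abs T z = -((t : ℂ) • z) := by
    rw [hz, map_sub, map_smul, ← mul_apply_eq_comp, CFC.abs_mul_abs, hx, ← Complex.coe_smul,
      Complex.ofReal_pow, smul_sub, smul_smul, sq]
    abel
  have h2 := re_inner_abs_nonneg T z
  rw [h1, inner_neg_left, inner_smul_left, Complex.conj_ofReal, Complex.neg_re,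
    Complex.re_ofReal_mul, ← RCLike.re_to_complex, inner_self_eq_norm_sq] at h2
  by_contra hne
  have : 0 < t * ‖z‖ ^ 2 := mul_pos ht (pow_pos (norm_pos_iff.2 hne) 2)
  linarith

/-! ### Orbits of extremal growth -/

lemma IsQuasinormal.inner_star_mul_self_pow {T : H →L[ℂ] H} (hq : IsQuasinormal T) (n : ℕ)
    (x y : H) : ⟪((star T * T) ^ n) x, y⟫_ℂ = ⟪(T ^ n) x, (T ^ n) y⟫_ℂ := by
  induction n generalizing x y with
  | zero => simp
  | succ n ih =>
    rw [pow_succ', mul_apply_eq_comp, inner_star_mul_self, ← mul_apply_eq_comp,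
      ← (hq.commute_star_mul_self.pow_left n).eq, mul_apply_eq_comp, ih, pow_succ,
      mul_apply_eq_comp, mul_apply_eq_comp]

/-- If the orbit of a vector grows as fast as the powers of the norm, then the norm is an eigenvalue
of the modulus. -/
lemma IsQuasinormal.norm_mem_pointSpectrum {T : H →L[ℂ] H} (hq : IsQuasinormal T) (hT : 0 < ‖T‖)
    {x : H} {δ : ℝ} (hδ : 0 < δ) (h : ∀ n : ℕ, δ * (‖T‖ ^ 2) ^ n ≤ ‖(T ^ n) x‖ ^ 2) :
    ((‖T‖ : ℝ) : ℂ) ∈ pointSpectrum (CFC.abs T) := by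
  by_contra hcon
  set f : H →L[ℂ] H := (((‖T‖ ^ 2)⁻¹ : ℝ) : ℂ) • (star T * T) with hf
  have hf1 : ‖f‖ ≤ 1 := by
    rw [hf, norm_smul, CStarRing.norm_star_mul_self, Complex.norm_real, norm_inv, norm_pow,
      norm_norm, ← sq, inv_mul_cancel₀ (by positivity)]
  have hfix : f.eqLocus (1 : H →L[ℂ] H) = ⊥ := by
    rw [Submodule.eq_bot_iff]
    intro y hy
    by_contra hy0
    refine hcon (mem_pointSpectrum_abs hT hy0 ?_)
    have hy : f y = y := hy
    conv_rhs => rw [← hy]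
    rw [hf, smul_apply, ← Complex.coe_smul, smul_smul, ← Complex.ofReal_mul,
      mul_inv_cancel₀ (by positivity), Complex.ofReal_one, one_smul]
  -- Mean ergodic theorem: with no fixed vectors the averages of `fᵏ x` tend to `0`, yet each `⟪fᵏ
  -- x, x⟫ = ‖Tᵏ x‖² / ‖T‖²ᵏ` is at least `δ`.
  have hlim := f.tendsto_birkhoffAverage_orthogonalProjection hf1 x
  have hzero : (((f.eqLocus (1 : H →L[ℂ] H)).orthogonalProjectionOnto x :
      f.eqLocus (1 : H →L[ℂ] H)) : H) = 0 := by
    exact (Submodule.eq_bot_iff _).1 hfix _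
      ((f.eqLocus (1 : H →L[ℂ] H)).orthogonalProjectionOnto x).2
  rw [hzero] at hlim
  have hlim' : Tendsto (fun N => (⟪birkhoffAverage ℂ f _root_.id N x, x⟫_ℂ).re) atTop (𝓝 0) := by
    have := (Complex.continuous_re.tendsto _).comp
      (hlim.inner (tendsto_const_nhds (x := x) (f := atTop)) (𝕜 := ℂ))
    simpa [Function.comp_def] using this
  refine hδ.not_ge (ge_of_tendsto hlim' ?_)
  filter_upwards [eventually_gt_atTop 0] with N hN
  have hterm : ∀ k, δ ≤ (⟪f^[k] x, x⟫_ℂ).re := fun k => by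
    have hk : f^[k] x = (((((‖T‖ ^ 2) ^ k)⁻¹ : ℝ)) : ℂ) • ((star T * T) ^ k) x := by
      rw [← FunLike.coe_pow_eq_iterate, hf, smul_pow, smul_apply, ← Complex.ofReal_pow, inv_pow]
    rw [hk, inner_smul_left, Complex.conj_ofReal, Complex.re_ofReal_mul,
      hq.inner_star_mul_self_pow, inner_self_eq_norm_sq_to_K, ← div_eq_inv_mul,
      le_div_iff₀ (by positivity)]
    exact_mod_cast h k
  have hN' : (0 : ℝ) < N := Nat.cast_pos.2 hN
  have hsum : (⟪birkhoffAverage ℂ f _root_.id N x, x⟫_ℂ).re =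
      (N : ℝ)⁻¹ * ∑ k ∈ Finset.range N, (⟪f^[k] x, x⟫_ℂ).re := by
    rw [birkhoffAverage, birkhoffSum, inner_smul_left, sum_inner, ← Complex.re_sum,
      ← Complex.re_ofReal_mul]
    simp
  rw [hsum, ← div_eq_inv_mul, le_div_iff₀ hN']
  calc δ * N = ∑ k ∈ Finset.range N, δ := by simp [mul_comm]
    _ ≤ _ := Finset.sum_le_sum fun k _ => hterm k

/-- If the orbit of a vector grows only as the powers of the lower bound of the modulus, then the
vector is an eigenvector of the modulus. -/
lemma IsQuasinormal.abs_apply_eq_of_norm_pow_le {T : H →L[ℂ] H} (hq : IsQuasinormal T)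
    (hm : 0 < lowerBd (CFC.abs T)) {y : H} {K : ℝ}
    (h : ∀ n : ℕ, ‖(T ^ n) y‖ ^ 2 ≤ K * (lowerBd (CFC.abs T) ^ 2) ^ n) :
    CFC.abs T y = (lowerBd (CFC.abs T) : ℂ) • y := by
  set m := lowerBd (CFC.abs T) with hmdef
  set B := CFC.abs T with hB
  set z := B y - (m : ℂ) • y with hz
  have hstep : ∀ x, m ^ 2 * ‖x‖ ^ 2 + ‖B x - (m : ℂ) • x‖ ^ 2 ≤ ‖B x‖ ^ 2 := fun x => by
    have h1 := lowerBd_abs_mul_le T x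
    have h2 := norm_sub_sq (𝕜 := ℂ) (B x) ((m : ℂ) • x)
    rw [inner_smul_right, norm_smul, Complex.norm_real, Real.norm_of_nonneg hm.le,
      RCLike.re_to_complex, Complex.re_ofReal_mul] at h2
    rw [h2]
    nlinarith
  -- Each application of `hstep` adds a defect `‖Bⁿ z‖² ≥ m²ⁿ ‖z‖²`. The accumulated factor `n`
  -- contradicts the bound by `K` unless `z = 0`.
  have hgrow : ∀ n : ℕ, (m ^ 2) ^ n * (n * ‖z‖ ^ 2) ≤ m ^ 2 * ‖(T ^ n) y‖ ^ 2 := fun n => by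
    induction n with
    | zero => simp; positivity
    | succ n ih =>
      have h1 := hstep ((B ^ n) y)
      have h2 : B ((B ^ n) y) - (m : ℂ) • (B ^ n) y = (B ^ n) z := by
        rw [hz, map_sub, map_smul, ← mul_apply_eq_comp, ← mul_apply_eq_comp, ← pow_succ,
          ← pow_succ']
      have h3 := pow_le_pow_left₀ (by positivity) (lowerBd_abs_pow_mul_norm_le T n z) 2
      rw [h2, ← mul_apply_eq_comp, ← pow_succ', hB, hq.norm_abs_pow_apply, hq.norm_abs_pow_apply,
        hq.norm_abs_pow_apply] at h1
      rw [← hB, ← hmdef, mul_pow, ← pow_mul, mul_comm n 2, pow_mul] at h3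
      have h4 : (m ^ 2) ^ (n + 1) * (((n + 1 : ℕ) : ℝ) * ‖z‖ ^ 2) =
          m ^ 2 * ((m ^ 2) ^ n * (n * ‖z‖ ^ 2) + (m ^ 2) ^ n * ‖z‖ ^ 2) := by
        push_cast
        ring
      rw [h4]
      refine mul_le_mul_of_nonneg_left ?_ (by positivity)
      linarith
  by_contra hne
  have hz0 : 0 < ‖z‖ ^ 2 := pow_pos (norm_pos_iff.2 (sub_ne_zero.2 hne)) 2
  obtain ⟨n, hn⟩ := exists_nat_gt (m ^ 2 * K / ‖z‖ ^ 2)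
  rw [div_lt_iff₀ hz0] at hn
  have hmn : 0 < (m ^ 2) ^ n := by positivity
  have h5 := (hgrow n).trans (mul_le_mul_of_nonneg_left (h n) (by positivity))
  have h6 : (m ^ 2) ^ n * (n * ‖z‖ ^ 2) ≤ (m ^ 2) ^ n * (m ^ 2 * K) := by
    calc _ ≤ _ := h5
      _ = _ := by ring
  exact hn.not_ge (le_of_mul_le_mul_left h6 hmn)

/-! ### Bounds for extended eigenvalues -/

lemma div_norm_le_of_mem_extSpectrum {T : H →L[ℂ] H} (hT : 0 < ‖T‖) {μ : ℂ}
    (hμ : μ ∈ extSpectrum T) : lowerBd (CFC.abs T) / ‖T‖ ≤ ‖μ‖ := by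
  obtain ⟨X, hX0, hX⟩ := hμ
  set m := lowerBd (CFC.abs T)
  by_contra! hlt
  have hm : 0 < m := by
    by_contra! hm
    exact (hlt.trans_le (div_nonpos_of_nonpos_of_nonneg hm hT.le)).not_ge (norm_nonneg μ)
  rw [lt_div_iff₀ hT] at hlt
  refine hX0 (ext fun x => ?_)
  have hbound : ∀ n : ℕ, ‖X x‖ ≤ (‖μ‖ * ‖T‖ / m) ^ n * (‖X‖ * ‖x‖) := fun n => by
    have h1 : m ^ n * ‖X x‖ ≤ (‖μ‖ * ‖T‖) ^ n * (‖X‖ * ‖x‖) :=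
      calc m ^ n * ‖X x‖ ≤ ‖(T ^ n) (X x)‖ := lowerBd_abs_pow_mul_norm_le T n (X x)
        _ ≤ ‖μ‖ ^ n * (‖X‖ * ‖(T ^ n) x‖) := norm_pow_apply_le_of_mul_eq hX n x
        _ ≤ ‖μ‖ ^ n * (‖X‖ * (‖T‖ ^ n * ‖x‖)) := by
          gcongr
          exact norm_pow_apply_le_opNorm_pow T n x
        _ = (‖μ‖ * ‖T‖) ^ n * (‖X‖ * ‖x‖) := by ring
    rw [div_pow, div_mul_eq_mul_div, le_div_iff₀ (by positivity), mul_comm]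
    exact h1
  have hlim : Tendsto (fun n : ℕ => (‖μ‖ * ‖T‖ / m) ^ n * (‖X‖ * ‖x‖)) atTop (𝓝 0) := by
    simpa using (tendsto_pow_atTop_nhds_zero_of_lt_one (by positivity)
      ((div_lt_one hm).2 hlt)).mul_const (‖X‖ * ‖x‖)
  exact norm_le_zero_iff.1 (ge_of_tendsto' hlim hbound)

/-- At the critical modulus, `hkey` caps the orbit of `X x` at order `mⁿ` and keeps that of `x` at
order `‖T‖ⁿ` or more. -/
lemma mem_pointSpectrum_of_mem_extSpectrum {T : H →L[ℂ] H} (hq : IsQuasinormal T)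
    (hm : 0 < lowerBd (CFC.abs T)) (hT : 0 < ‖T‖) {μ : ℂ} (hμ : μ ∈ extSpectrum T)
    (hnorm : ‖μ‖ = lowerBd (CFC.abs T) / ‖T‖) :
    ((lowerBd (CFC.abs T) : ℝ) : ℂ) ∈ pointSpectrum (CFC.abs T) ∧
      ((‖T‖ : ℝ) : ℂ) ∈ pointSpectrum (CFC.abs T) := by
  obtain ⟨X, hX0, hX⟩ := hμ
  obtain ⟨x, hx⟩ : ∃ x, X x ≠ 0 := by
    by_contra! h
    exact hX0 (ext h)
  set m := lowerBd (CFC.abs T)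
  have hXn : 0 < ‖X‖ := norm_pos_iff.2 hX0
  have hXx : 0 < ‖X x‖ := norm_pos_iff.2 hx
  have hkey : ∀ n : ℕ, ‖T‖ ^ n * ‖(T ^ n) (X x)‖ ≤ m ^ n * (‖X‖ * ‖(T ^ n) x‖) := fun n => by
    have h := norm_pow_apply_le_of_mul_eq hX n x
    rw [hnorm, div_pow, div_mul_eq_mul_div, le_div_iff₀ (by positivity)] at h
    rwa [mul_comm]
  constructor
  · refine mem_pointSpectrum_iff.2 ⟨X x, hx,
      hq.abs_apply_eq_of_norm_pow_le hm (K := (‖X‖ * ‖x‖) ^ 2) fun n => ?_⟩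
    have h1 : ‖(T ^ n) x‖ ≤ ‖T‖ ^ n * ‖x‖ := norm_pow_apply_le_opNorm_pow T n x
    have h2 : ‖T‖ ^ n * ‖(T ^ n) (X x)‖ ≤ ‖T‖ ^ n * (m ^ n * (‖X‖ * ‖x‖)) :=
      calc _ ≤ _ := hkey n
        _ ≤ m ^ n * (‖X‖ * (‖T‖ ^ n * ‖x‖)) := by gcongr
        _ = _ := by ring
    have h3 := pow_le_pow_left₀ (norm_nonneg _) (le_of_mul_le_mul_left h2 (by positivity)) 2
    calc _ ≤ _ := h3
      _ = _ := by ring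
  · refine hq.norm_mem_pointSpectrum hT (x := x) (δ := (‖X x‖ / ‖X‖) ^ 2) (by positivity)
      fun n => ?_
    have h1 : m ^ n * (‖T‖ ^ n * ‖X x‖) ≤ m ^ n * (‖X‖ * ‖(T ^ n) x‖) :=
      calc _ = ‖T‖ ^ n * (m ^ n * ‖X x‖) := by ring
        _ ≤ ‖T‖ ^ n * ‖(T ^ n) (X x)‖ := by
          gcongr
          exact lowerBd_abs_pow_mul_norm_le T n (X x)
        _ ≤ _ := hkey n
    have h2 : ‖X x‖ / ‖X‖ * ‖T‖ ^ n ≤ ‖(T ^ n) x‖ := by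
      rw [div_mul_eq_mul_div, div_le_iff₀ hXn, mul_comm, mul_comm _ ‖X‖]
      exact le_of_mul_le_mul_left h1 (by positivity)
    have h3 := pow_le_pow_left₀ (by positivity) h2 2
    calc _ = _ := by ring
      _ ≤ _ := h3

/-! ### Existence of extended eigenvalues -/

lemma mem_extSpectrum_of_div_norm_lt [Nontrivial H] {T : H →L[ℂ] H} (hp : IsPure T)
    (hq : IsQuasinormal T) (hT : 0 < ‖T‖) {μ : ℂ} (hμ : lowerBd (CFC.abs T) / ‖T‖ < ‖μ‖) :
    μ ∈ extSpectrum T := by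
  have hm := lowerBd_abs_nonneg T
  have hμ0 : 0 < ‖μ‖ := (div_nonneg hm hT.le).trans_lt hμ
  rw [div_lt_iff₀ hT] at hμ
  -- Taking `b = a / |μ|` makes `a / b = |μ|` while `b < ‖T‖`.
  obtain ⟨a, hma, haμ⟩ := exists_between hμ
  have haT : a / ‖μ‖ < ‖T‖ := by rwa [div_lt_iff₀ hμ0, mul_comm]
  have ha : 0 < a := hm.trans_lt hma
  refine mem_extSpectrum_of_posPart hp hq ha.le (div_pos ha hμ0) (exists_posPart_of_lowerBd_lt hma)
    (exists_posPart_of_lt_norm (div_pos ha hμ0).le haT) (norm_pos_iff.1 hμ0) ?_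
  rw [div_div_cancel₀ ha.ne']

lemma mem_extSpectrum_of_mem_pointSpectrum {T : H →L[ℂ] H} (hp : IsPure T)
    (hq : IsQuasinormal T) (hT : 0 < ‖T‖) (hm : 0 < lowerBd (CFC.abs T))
    (h1 : ((lowerBd (CFC.abs T) : ℝ) : ℂ) ∈ pointSpectrum (CFC.abs T))
    (h2 : ((‖T‖ : ℝ) : ℂ) ∈ pointSpectrum (CFC.abs T)) {μ : ℂ}
    (hμ : lowerBd (CFC.abs T) / ‖T‖ ≤ ‖μ‖) : μ ∈ extSpectrum T := by
  obtain ⟨x, hx0, hx⟩ := exists_star_mul_self_apply_eq h1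
  obtain ⟨y, hy0, hy⟩ := exists_star_mul_self_apply_eq h2
  refine mem_extSpectrum_of_posPart hp hq hm.le hT ⟨x, hx0, posPart_apply_eq_zero
      ((IsSelfAdjoint.star_mul_self T).sub (isSelfAdjoint_smul_one _)) ?_⟩
    ⟨y, hy0, posPart_apply_eq_zero
      ((isSelfAdjoint_smul_one _).sub (IsSelfAdjoint.star_mul_self T)) ?_⟩
    (norm_pos_iff.1 ((div_pos hm hT).trans_le hμ)) hμ
  · rw [sub_apply, hx, sub_self]
  · rw [sub_apply, hy, sub_self]

lemma IsPure.norm_pos [Nontrivial H] {T : H →L[ℂ] H} (hp : IsPure T) (hq : IsQuasinormal T) :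
    0 < ‖T‖ := by
  obtain ⟨x, hx⟩ := exists_ne (0 : H)
  refine norm_pos_iff.2 fun h => hx (hp.injective hq ?_)
  rw [h, zero_apply]

lemma IsPure.zero_notMem_extSpectrum {T : H →L[ℂ] H} (hp : IsPure T) (hq : IsQuasinormal T) :
    (0 : ℂ) ∉ extSpectrum T := by
  rintro ⟨X, hX0, hX⟩
  refine hX0 (ext fun x => hp.injective hq ?_)
  have h : T (X x) = (0 : ℂ) • X (T x) := congr($hX x)
  rwa [zero_smul] at h

lemma IsPure.zero_notMem_pointSpectrum_abs {T : H →L[ℂ] H} (hp : IsPure T)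
    (hq : IsQuasinormal T) : (0 : ℂ) ∉ pointSpectrum (CFC.abs T) := by
  intro h
  obtain ⟨x, hx0, hx⟩ := mem_pointSpectrum_iff.1 h
  refine hx0 (hp.injective hq (norm_eq_zero.1 ?_))
  rw [← norm_abs_apply, hx, zero_smul, norm_zero]

end ExtendedSpectrum

theorem corollary2p5 {H : Type*} [NormedAddCommGroup H] [InnerProductSpace ℂ H]
    [CompleteSpace H] [Nontrivial H] (T : H →L[ℂ] H)
    (hq : ExtendedSpectrum.IsQuasinormal T) (hp : ExtendedSpectrum.IsPure T) :
    ((((ExtendedSpectrum.lowerBd (CFC.abs T) : ℝ) : ℂ) ∈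
          ExtendedSpectrum.pointSpectrum (CFC.abs T) ∧
        ((‖T‖ : ℝ) : ℂ) ∈ ExtendedSpectrum.pointSpectrum (CFC.abs T)) →
      ExtendedSpectrum.extSpectrum T =
        (Metric.ball (0 : ℂ) (ExtendedSpectrum.lowerBd (CFC.abs T) / ‖T‖))ᶜ) ∧
    (¬ (((ExtendedSpectrum.lowerBd (CFC.abs T) : ℝ) : ℂ) ∈
          ExtendedSpectrum.pointSpectrum (CFC.abs T) ∧
        ((‖T‖ : ℝ) : ℂ) ∈ ExtendedSpectrum.pointSpectrum (CFC.abs T)) →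
      ExtendedSpectrum.extSpectrum T =
        (Metric.closedBall (0 : ℂ) (ExtendedSpectrum.lowerBd (CFC.abs T) / ‖T‖))ᶜ) := by
  have hT := hp.norm_pos hq
  have hm := ExtendedSpectrum.lowerBd_abs_nonneg T
  refine ⟨fun ⟨h1, h2⟩ => ?_, fun h => ?_⟩
  · ext μ
    rw [Set.mem_compl_iff, mem_ball_zero_iff, not_lt]
    refine ⟨ExtendedSpectrum.div_norm_le_of_mem_extSpectrum hT, fun hμ => ?_⟩
    have hm0 : ExtendedSpectrum.lowerBd (CFC.abs T) ≠ 0 := fun h0 => by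
      rw [h0, Complex.ofReal_zero] at h1
      exact hp.zero_notMem_pointSpectrum_abs hq h1
    exact ExtendedSpectrum.mem_extSpectrum_of_mem_pointSpectrum hp hq hT
      (lt_of_le_of_ne hm hm0.symm) h1 h2 hμ
  · ext μ
    rw [Set.mem_compl_iff, mem_closedBall_zero_iff, not_le]
    refine ⟨fun hμ => ?_, ExtendedSpectrum.mem_extSpectrum_of_div_norm_lt hp hq hT⟩
    refine lt_of_le_of_ne (ExtendedSpectrum.div_norm_le_of_mem_extSpectrum hT hμ) fun heq => ?_
    -- For `m = 0` the critical circle is the point `0`, excluded by injectivity whatever the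
    -- eigenvalues.
    rcases hm.eq_or_lt with h0 | h0
    · rw [← h0, zero_div] at heq
      rw [norm_eq_zero.1 heq.symm] at hμ
      exact hp.zero_notMem_extSpectrum hq hμ
    · exact h (ExtendedSpectrum.mem_pointSpectrum_of_mem_extSpectrum hq h0 hT hμ heq.symm)
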